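/- Let $n \ge 1$. (a) Let $a_1,\dots,a_{2n-1}\ge 0$ be integers with $a_i = a_{2n-i}$ for all $i$, and let $[a_1,\dots,a_{n-1},a_n,a_{n-1},\dots,a_1]$ be the (selfdual) irreducible finite-dimensional algebraic representation of $\mathrm{SL}_{2n}(\mathbb{C})$ with highest weight $\sum_{i=1}^{2n-1} a_i\varpi_i$, where $\varpi_i = e_1+\cdots+e_i$ is the highest weight of $\Lambda^i(\mathbb{C}^{2n})$ (with respect to the diagonal torus and the upper triangular Borel subgroup). Then the center of $\mathrm{SL}_{2n}(\mathbb{C})$ acts on this representation through a (unique) character $\omega$, the central character; it satisfies $\omega^2=1$, and $\omega$ is trivial if and only if $a_n$ is even. (b) Let $a_1,\dots,a_n\ge 0$ be integers, and let $[a_1,\dots,a_n]$ be the irreducible finite-dimensional algebraic representation of $\mathrm{Spin}_{2n+1}(\mathbb{C})$ with highest weight $\sum_{i=1}^{n} a_i\varpi_i$, where $\varpi_i=e_1+\cdots+e_i$ for $1\le i\le n-1$, and $\varpi_n=(e_1+\cdots+e_n)/2$ is the highest weight of the spin representation, with respect to the standard maximal torus and Borel subgroup. Then the center of $\mathrm{Spin}_{2n+1}(\mathbb{C})$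 acts on this representation through a (unique) character $\omega$; it satisfies $\omega^2=1$, and $\omega$ is trivial if and only if $a_n$ is even. -/

import Mathlib

noncomputable section

/-! ### Representations, central characters, highest weights -/

/-- A representation `ρ` of `G` is algebraic with respect to a closed embedding `i` of the linear
algebraic group `G` in a finite dimensional algebra `A` if all its matrix coefficients are regular
functions, that is, polynomials in the coordinates of `A` restricted to `G`. -/
def IsAlgebraicRep {G A V : Type*} [Group G] [Ring A] [Algebra ℂ A] [AddCommGroup V] [Module ℂ V]
    (i : G → A) (ρ : Representation ℂ G V) : Prop :=
  ∀ (v : V) (f : Module.Dual ℂ V), (fun g : G => f (ρ g v)) ∈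
    Algebra.adjoin ℂ {h : G → ℂ | ∃ φ : Module.Dual ℂ A, h = fun g => φ (i g)}

/-- `ω` is the central character of `ρ`: the centre of `G` acts on `V` through `ω`. -/
def IsCentralCharacter {G V : Type*} [Group G] [AddCommGroup V] [Module ℂ V]
    (ρ : Representation ℂ G V) (ω : Subgroup.center G →* ℂˣ) : Prop :=
  ∀ (z : Subgroup.center G) (v : V), ρ (z : G) v = (ω z : ℂ) • v

/-- `ρ` has a highest weight vector of weight `χ`: a nonzero vector spanning a line stable under
the Borel subgroup `B`, on which the element `t s` of the maximal torus
(parametrised by `t : S → G`) acts by `χ s`. -/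
def HasHighestWeight {G S V : Type*} [Group G] [AddCommGroup V] [Module ℂ V]
    (ρ : Representation ℂ G V) (B : Set G) (t : S → G) (χ : S → ℂ) : Prop :=
  ∃ v : V, v ≠ 0 ∧ (∀ g ∈ B, ∃ c : ℂ, ρ g v = c • v) ∧ ∀ s : S, ρ (t s) v = χ s • v

/-! ### The group `SL_N(ℂ)` -/

/-- The Borel subgroup of upper triangular matrices. -/
def slBorel (N : ℕ) : Set (Matrix.SpecialLinearGroup (Fin N) ℂ) :=
  {g | (g : Matrix (Fin N) (Fin N) ℂ).BlockTriangular id}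

/-- The maximal torus of diagonal matrices. -/
abbrev SLTorus (N : ℕ) : Type :=
  {g : Matrix.SpecialLinearGroup (Fin N) ℂ // (g : Matrix (Fin N) (Fin N) ℂ).IsDiag}

/-- The value at a diagonal matrix of the weight `a₁ϖ₁ + ⋯ + a_{N-1}ϖ_{N-1}`, where
`ϖᵢ = e₁ + ⋯ + eᵢ` (the indices are shifted by one: `aᵢ` is `a (i - 1)`). -/
def slWeight (N : ℕ) (a : Fin (N - 1) → ℕ) (g : SLTorus N) : ℂ :=
  ∏ i : Fin (N - 1),
    (∏ j ∈ Finset.univ.filter (fun j : Fin N => (j : ℕ) ≤ (i : ℕ)),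
      (g.1 : Matrix (Fin N) (Fin N) ℂ) j j) ^ a i

/-- `ρ` is (isomorphic to) the representation `[a₁, …, a_{N-1}]` of `SL_N(ℂ)`: the irreducible
algebraic representation of highest weight `a₁ϖ₁ + ⋯ + a_{N-1}ϖ_{N-1}`. -/
structure IsSLRep (N : ℕ) (a : Fin (N - 1) → ℕ) {V : Type*} [AddCommGroup V] [Module ℂ V]
    (ρ : Representation ℂ (Matrix.SpecialLinearGroup (Fin N) ℂ) V) : Prop where
  finiteDimensional : FiniteDimensional ℂ V
  irreducible : ρ.IsIrreducible
  algebraic : IsAlgebraicRep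
    (fun g : Matrix.SpecialLinearGroup (Fin N) ℂ => (g : Matrix (Fin N) (Fin N) ℂ)) ρ
  highestWeight : HasHighestWeight ρ (slBorel N) (fun g : SLTorus N => g.1) (slWeight N a)

/-! ### The group `Spin_{2n+1}(ℂ)` -/

/-- The quadratic space `ℂ^{2n+1}`, with coordinates `(x, y, z)`. -/
abbrev OddSpace (n : ℕ) : Type := (Fin n → ℂ) × (Fin n → ℂ) × ℂ

/-- The nondegenerate quadratic form `x₁y₁ + ⋯ + xₙyₙ + z²` on `ℂ^{2n+1}` (over `ℂ` any
nondegenerate quadratic form is equivalent to it). -/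
def oddForm (n : ℕ) : QuadraticForm ℂ (OddSpace n) :=
  (∑ i : Fin n, QuadraticMap.linMulLin
    ((LinearMap.proj i : (Fin n → ℂ) →ₗ[ℂ] ℂ) ∘ₗ LinearMap.fst ℂ (Fin n → ℂ) ((Fin n → ℂ) × ℂ))
    ((LinearMap.proj i : (Fin n → ℂ) →ₗ[ℂ] ℂ) ∘ₗ LinearMap.fst ℂ (Fin n → ℂ) ℂ ∘ₗ
      LinearMap.snd ℂ (Fin n → ℂ) ((Fin n → ℂ) × ℂ)))
  + QuadraticMap.linMulLin
      (LinearMap.snd ℂ (Fin n → ℂ) ℂ ∘ₗ LinearMap.snd ℂ (Fin n → ℂ) ((Fin n → ℂ) × ℂ))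
      (LinearMap.snd ℂ (Fin n → ℂ) ℂ ∘ₗ LinearMap.snd ℂ (Fin n → ℂ) ((Fin n → ℂ) × ℂ))

theorem oddForm_apply (n : ℕ) (v : OddSpace n) :
    oddForm n v = (∑ i : Fin n, v.1 i * v.2.1 i) + v.2.2 * v.2.2 := by
  simp [oddForm]

/-- The complex spin group `Spin_{2n+1}(ℂ)`, inside the Clifford algebra. -/
abbrev OddSpin (n : ℕ) : Type := spinGroup (oddForm n)

/-- The basis vector `eᵢ` (the `xᵢ`-axis). -/
def vecE (n : ℕ) (i : Fin n) : OddSpace n := (Pi.single i 1, 0, 0)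

/-- The basis vector `fᵢ` (the `yᵢ`-axis), dual to `eᵢ`. -/
def vecF (n : ℕ) (i : Fin n) : OddSpace n := (0, Pi.single i 1, 0)

theorem oddForm_vec (n : ℕ) (i : Fin n) (c d : ℂ) :
    oddForm n (c • vecE n i + d • vecF n i) = c * d := by
  simp [oddForm_apply, vecE, vecF, Pi.single_apply]

theorem mul_mem_spinGroup {M : Type*} [AddCommGroup M] [Module ℂ M] (Q : QuadraticForm ℂ M)
    {v w : M} (hv : Q v = 1) (hw : Q w = 1) :
    CliffordAlgebra.ι Q v * CliffordAlgebra.ι Q w ∈ spinGroup Q := by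
  have sq : ∀ {u : M}, Q u = 1 → CliffordAlgebra.ι Q u * CliffordAlgebra.ι Q u = 1 := by
    intro u hu
    rw [CliffordAlgebra.ι_sq_scalar, hu, map_one]
  have unit : ∀ {u : M}, Q u = 1 → ∃ y ∈ lipschitzGroup Q,
      (y : CliffordAlgebra Q) = CliffordAlgebra.ι Q u := by
    intro u hu
    exact ⟨⟨_, _, sq hu, sq hu⟩, Subgroup.subset_closure ⟨u, rfl⟩, rfl⟩
  have hst : star (CliffordAlgebra.ι Q v * CliffordAlgebra.ι Q w)
      = CliffordAlgebra.ι Q w * CliffordAlgebra.ι Q v := by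
    simp [CliffordAlgebra.star_ι]
  refine spinGroup.mem_iff.2 ⟨pinGroup.mem_iff.2 ⟨?_, ?_⟩, ?_⟩
  · obtain ⟨y, hy, hyv⟩ := unit hv
    obtain ⟨z, hz, hzw⟩ := unit hw
    exact ⟨y * z, mul_mem hy hz, by simp [hyv, hzw]⟩
  · rw [Unitary.mem_iff, hst]
    constructor
    · rw [mul_assoc, ← mul_assoc _ _ (CliffordAlgebra.ι Q w), sq hv, one_mul, sq hw]
    · rw [mul_assoc, ← mul_assoc _ _ (CliffordAlgebra.ι Q v), sq hw, one_mul, sq hv]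
  · exact CliffordAlgebra.ι_mul_ι_mem_evenOdd_zero Q v w

/-- The one-parameter subgroup `s ↦ s eᵢfᵢ + s⁻¹ fᵢeᵢ` of `Spin_{2n+1}(ℂ)`, written as a product
of two vectors. In the vector representation it multiplies `eᵢ` by `s²` and `fᵢ` by `s⁻²`. -/
def spinCochar (n : ℕ) (i : Fin n) (s : ℂˣ) : OddSpin n :=
  ⟨CliffordAlgebra.ι (oddForm n) ((1 : ℂ) • vecE n i + (1 : ℂ) • vecF n i) *
      CliffordAlgebra.ι (oddForm n) (((s⁻¹ : ℂˣ) : ℂ) • vecE n i + (s : ℂ) • vecF n i),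
    mul_mem_spinGroup _ (by rw [oddForm_vec, one_mul]) (by rw [oddForm_vec, Units.inv_mul])⟩

/-- The maximal torus of `Spin_{2n+1}(ℂ)`: the element with parameters `s₁, …, sₙ` acts on `eᵢ`
by `sᵢ²`, so that the weight `eᵢ` of the torus takes the value `sᵢ²` at it
(the factors commute). -/
def spinTorus (n : ℕ) (s : Fin n → ℂˣ) : OddSpin n :=
  (List.ofFn fun i => spinCochar n i (s i)).prod

/-- The isotropic subspace `⟨e₁, …, eₖ⟩`. -/
def isoFlag (n k : ℕ) : Submodule ℂ (OddSpace n) :=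
  Submodule.span ℂ {w | ∃ j : Fin n, (j : ℕ) < k ∧ w = vecE n j}

/-- The Borel subgroup of `Spin_{2n+1}(ℂ)`: the stabiliser of the isotropic flag
`⟨e₁⟩ ⊂ ⟨e₁, e₂⟩ ⊂ ⋯ ⊂ ⟨e₁, …, eₙ⟩` under conjugation on vectors. -/
def spinBorel (n : ℕ) : Set (OddSpin n) :=
  {g | ∀ k ≤ n, ∀ w ∈ isoFlag n k, ∃ w' ∈ isoFlag n k,
    (g : CliffordAlgebra (oddForm n)) * CliffordAlgebra.ι (oddForm n) w *
      ((g⁻¹ : OddSpin n) : CliffordAlgebra (oddForm n)) = CliffordAlgebra.ι (oddForm n) w'}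

/-- The value at `spinTorus n s` of the fundamental weight with (shifted) index `i`:
`ϖᵢ = e₁ + ⋯ + eᵢ` for `i < n` and `ϖₙ = (e₁ + ⋯ + eₙ)/2`, where `eⱼ` has the value `sⱼ²`
and `ϖₙ` the value `s₁⋯sₙ`. -/
def spinFundWeight (n : ℕ) (i : Fin n) (s : Fin n → ℂˣ) : ℂ :=
  if (i : ℕ) + 1 < n then
    ∏ j ∈ Finset.univ.filter (fun j : Fin n => (j : ℕ) ≤ (i : ℕ)), (s j : ℂ) ^ 2
  else ∏ j : Fin n, (s j : ℂ)

/-- The value at `spinTorus n s` of the weight `a₁ϖ₁ + ⋯ + aₙϖₙ`. -/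
def spinWeight (n : ℕ) (a : Fin n → ℕ) (s : Fin n → ℂˣ) : ℂ :=
  ∏ i : Fin n, spinFundWeight n i s ^ a i

/-- `ρ` is (isomorphic to) the representation `[a₁, …, aₙ]` of `Spin_{2n+1}(ℂ)`: the irreducible
algebraic representation of highest weight `a₁ϖ₁ + ⋯ + aₙϖₙ`. -/
structure IsSpinRep (n : ℕ) (a : Fin n → ℕ) {V : Type*} [AddCommGroup V] [Module ℂ V]
    (ρ : Representation ℂ (OddSpin n) V) : Prop where
  finiteDimensional : FiniteDimensional ℂ V
  irreducible : ρ.IsIrreducible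
  algebraic : IsAlgebraicRep (fun g : OddSpin n => (g : CliffordAlgebra (oddForm n))) ρ
  highestWeight : HasHighestWeight ρ (spinBorel n) (spinTorus n) (spinWeight n a)

end

/-!
By Schur's lemma the centre acts on an irreducible representation by scalars, and since it is
contained in the maximal torus, these scalars are the values of the highest weight.

For `SL_{2n}(ℂ)` the centre consists of the `2n`-th roots of unity `r`, and `a₁ϖ₁ + ⋯` takes at `r`
the value `r ^ ∑ i aᵢ`. As `aᵢ = a_{2n-i}`, the terms of `i` and `2n - i` add up to a multiple of `2n`
and the value is `(r ^ n) ^ aₙ` (`prod_pow_of_selfdual`), with `r ^ n = ±1` taking both signs.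

For `Spin_{2n+1}(ℂ)` the centre is `{1, -1}`, and `-1` is the torus element with parameters
`(-1, 1, …, 1)`, where the highest weight has the value `(-1) ^ aₙ`. Most of the work is to determine
the centre. A central element `x` commutes with products of two unit vectors, hence with all vectors
(`commute_ι_of_commute_ι_mul_ι`); here the oddness of the dimension enters, through the fact that the
volume element is central (`eq_zero_of_anticomm_ι`). As `x` is even, its commutator with a vector is a
contraction (`CliffordAlgebra.ι_mul_sub_involute_mul_ι`), so all contractions kill `x`, and `x` is a
scalar (`CliffordAlgebra.mem_range_algebraMap_of_contractLeft_eq_zero`) with `x * x = 1`.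
-/

/-! ### Contractions in Clifford algebras -/

namespace CliffordAlgebra

variable {R M : Type*} [CommRing R] [AddCommGroup M] [Module R M]

/-- The twisted commutator with a vector `v` is the contraction with the linear form polar to `v`. -/
theorem ι_mul_sub_involute_mul_ι {Q : QuadraticForm R M} (v : M) (x : CliffordAlgebra Q) :
    ι Q v * x - involute x * ι Q v = contractLeft (QuadraticMap.polarBilin Q v) x := by
  induction x using CliffordAlgebra.left_induction with
  | algebraMap r =>
    rw [contractLeft_algebraMap, AlgHom.commutes, Algebra.commutes, sub_self]
  | add x y hx hy =>
    rw [map_add, map_add, ← hx, ← hy]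
    noncomm_ring
  | ι_mul x m hx =>
    have h := ι_mul_ι_add_swap (Q := Q) v m
    rw [contractLeft_ι_mul, ← hx, map_mul, involute_ι, Algebra.smul_def,
      QuadraticMap.polarBilin_apply_apply, ← h]
    noncomm_ring

/-- For the zero form (the exterior algebra), there is a linear map that fixes every element killed
by all contractions and kills the multiples of the basis vectors `b i`, `i ∈ s`. It is the composite
of the maps `x ↦ x - b i * (b.coord i ⌋ x)`. -/
theorem exists_projection_of_basis {κ : Type*} (b : Module.Basis κ R M) (s : Finset κ) :
    ∃ P : CliffordAlgebra (0 : QuadraticForm R M) →ₗ[R] CliffordAlgebra (0 : QuadraticForm R M),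
      (∀ x, (∀ d : Module.Dual R M, contractLeft d x = 0) → P x = x) ∧
      ∀ i ∈ s, ∀ y, P (ι 0 (b i) * y) = 0 := by
  classical
  induction s using Finset.induction_on with
  | empty => exact ⟨LinearMap.id, fun _ _ => rfl, by simp⟩
  | insert i s hi ih =>
    obtain ⟨P, hP, hPs⟩ := ih
    refine ⟨P ∘ₗ (LinearMap.id - LinearMap.mulLeft R (ι 0 (b i)) ∘ₗ contractLeft (b.coord i)),
      fun x hx => by simp [hx, hP x hx], fun j hj y => ?_⟩
    have sq : ι (0 : QuadraticForm R M) (b i) * ι 0 (b i) = 0 := by simp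
    have swap := ι_mul_ι_add_swap (Q := (0 : QuadraticForm R M)) (b i) (b j)
    rw [show QuadraticMap.polar (0 : QuadraticForm R M) (b i) (b j) = 0 by
      simp [QuadraticMap.polar], map_zero] at swap
    by_cases hij : j = i
    · subst hij
      simp only [LinearMap.comp_apply, LinearMap.sub_apply, LinearMap.id_apply,
        LinearMap.mulLeft_apply, contractLeft_ι_mul]
      rw [show b.coord j (b j) = 1 by simp, one_smul, mul_sub, ← mul_assoc, sq]
      simp
    · have hjs : j ∈ s := (Finset.mem_insert.1 hj).resolve_left hij
      simp only [LinearMap.comp_apply, LinearMap.sub_apply, LinearMap.id_apply,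
        LinearMap.mulLeft_apply, contractLeft_ι_mul]
      rw [show b.coord i (b j) = 0 by simp [hij], zero_smul, zero_sub, mul_neg, ← mul_assoc,
        eq_neg_of_add_eq_zero_left swap, neg_mul, neg_neg, mul_assoc, ← mul_sub, hPs j hjs]

/-- An element of a Clifford algebra killed by all contractions is a scalar. Contractions are
compatible with `changeForm`, which reduces this to the exterior algebra; there the projection of
`exists_projection_of_basis` for a whole basis has scalar values and fixes the element. -/
theorem mem_range_algebraMap_of_contractLeft_eq_zero [Invertible (2 : R)] [Module.Free R M]
    [Module.Finite R M] {Q : QuadraticForm R M} {x : CliffordAlgebra Q}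
    (hx : ∀ d : Module.Dual R M, contractLeft d x = 0) :
    ∃ r : R, x = algebraMap R _ r := by
  let b := Module.Free.chooseBasis R M
  have h : (QuadraticMap.associated (-Q) : LinearMap.BilinForm R M).toQuadraticMap = 0 - Q :=
    changeForm.associated_neg_proof
  obtain ⟨P, hP, hPs⟩ := exists_projection_of_basis b Finset.univ
  have hPι : ∀ m y, P (ι 0 m * y) = 0 := by
    intro m y
    rw [← b.sum_repr m, map_sum, Finset.sum_mul, map_sum]
    refine Finset.sum_eq_zero fun i _ => ?_
    rw [map_smul, smul_mul_assoc, map_smul, hPs i (Finset.mem_univ i), smul_zero]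
  have hr : ∀ y, ∃ r : R, P y = algebraMap R _ r := by
    intro y
    induction y using CliffordAlgebra.left_induction with
    | algebraMap r => exact ⟨r, hP _ fun d => contractLeft_algebraMap _ d r⟩
    | add y z hy hz =>
      obtain ⟨r, hr⟩ := hy
      obtain ⟨s, hs⟩ := hz
      exact ⟨r + s, by rw [map_add, hr, hs, map_add]⟩
    | ι_mul y m _ => exact ⟨0, by rw [hPι, map_zero]⟩
  obtain ⟨r, hr⟩ := hr (changeForm h x)
  refine ⟨r, (changeFormEquiv h).injective ?_⟩
  have : P (changeForm h x) = changeForm h x :=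
    hP _ fun d => by rw [← changeForm_contractLeft, hx, map_zero]
  change changeForm h x = changeForm h (algebraMap R _ r)
  rw [changeForm_algebraMap, ← hr, this]

theorem algebraMap_injective_of_invertible_two [Invertible (2 : R)] (Q : QuadraticForm R M) :
    Function.Injective (algebraMap R (CliffordAlgebra Q)) := by
  intro r s h
  have hB : (QuadraticMap.associated (-Q) : LinearMap.BilinForm R M).toQuadraticMap = 0 - Q :=
    changeForm.associated_neg_proof
  have h' := congrArg (changeForm hB) h
  rw [changeForm_algebraMap, changeForm_algebraMap] at h'
  exact (ExteriorAlgebra.algebraMap_leftInverse M).injective h'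

end CliffordAlgebra

/-! ### The centre of `Spin_{2n+1}(ℂ)` -/

section OddCenter

open CliffordAlgebra

variable {n : ℕ}

/-- The anisotropic basis vector of `ℂ^{2n+1}` orthogonal to all `eᵢ` and `fᵢ`. -/
def vecZ (n : ℕ) : OddSpace n := (0, 0, 1)

theorem oddSpace_decomp (v : OddSpace n) :
    v = ∑ i, v.1 i • vecE n i + ∑ i, v.2.1 i • vecF n i + v.2.2 • vecZ n := by
  ext j <;> simp [vecE, vecF, vecZ, Prod.fst_sum, Prod.snd_sum, Finset.sum_apply, Pi.single_apply]

theorem polar_oddForm (v w : OddSpace n) :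
    QuadraticMap.polar (oddForm n) v w =
      ∑ i, v.1 i * w.2.1 i + ∑ i, v.2.1 i * w.1 i + 2 * v.2.2 * w.2.2 := by
  simp only [QuadraticMap.polar, oddForm_apply, Prod.fst_add, Prod.snd_add, Pi.add_apply,
    add_mul, mul_add, Finset.sum_add_distrib]
  simp only [mul_comm (w.1 _)]
  ring

/-- The form `oddForm n` is nondegenerate: every linear form is polar to a vector. -/
theorem exists_polarBilin_oddForm_eq (d : Module.Dual ℂ (OddSpace n)) :
    ∃ v, QuadraticMap.polarBilin (oddForm n) v = d := by
  refine ⟨(fun i => d (vecF n i), fun i => d (vecE n i), d (vecZ n) / 2), ?_⟩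
  refine LinearMap.ext fun w => ?_
  conv_rhs => rw [oddSpace_decomp w]
  simp only [QuadraticMap.polarBilin_apply_apply, polar_oddForm, map_add, map_sum, map_smul,
    smul_eq_mul, mul_comm (d _)]
  ring

theorem induction_oddSpace {p : OddSpace n → Prop} (hE : ∀ i, p (vecE n i))
    (hF : ∀ i, p (vecF n i)) (hZ : p (vecZ n)) (add : ∀ v w, p v → p w → p (v + w))
    (smul : ∀ (c : ℂ) v, p v → p (c • v)) (v : OddSpace n) : p v := by
  have h0 : p 0 := by simpa using smul 0 _ hZ
  rw [oddSpace_decomp v]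
  exact add _ _ (add _ _ (Finset.sum_induction _ p add h0 fun i _ => smul _ _ (hE i))
    (Finset.sum_induction _ p add h0 fun i _ => smul _ _ (hF i))) (smul _ _ hZ)


theorem ι_mul_ι_of_polar_eq_zero {v w : OddSpace n}
    (h : QuadraticMap.polar (oddForm n) v w = 0) :
    ι (oddForm n) v * ι (oddForm n) w = -(ι (oddForm n) w * ι (oddForm n) v) := by
  rw [eq_neg_iff_add_eq_zero, ι_mul_ι_add_swap, h, map_zero]

theorem ι_vecZ_sq : ι (oddForm n) (vecZ n) * ι (oddForm n) (vecZ n) = 1 := by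
  rw [ι_sq_scalar, oddForm_apply]; simp [vecZ]

theorem ι_vecE_sq (i : Fin n) : ι (oddForm n) (vecE n i) * ι (oddForm n) (vecE n i) = 0 := by
  rw [ι_sq_scalar, oddForm_apply]; simp [vecE]

theorem ι_vecF_sq (i : Fin n) : ι (oddForm n) (vecF n i) * ι (oddForm n) (vecF n i) = 0 := by
  rw [ι_sq_scalar, oddForm_apply]; simp [vecF]

theorem ι_vecE_mul_ι_vecF (i : Fin n) :
    ι (oddForm n) (vecE n i) * ι (oddForm n) (vecF n i) =
      1 - ι (oddForm n) (vecF n i) * ι (oddForm n) (vecE n i) := by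
  rw [eq_sub_iff_add_eq, ι_mul_ι_add_swap, polar_oddForm]
  simp [vecE, vecF, Pi.single_apply]

/-- The volume element `eᵢfᵢ - fᵢeᵢ` of the hyperbolic plane `⟨eᵢ, fᵢ⟩`, normalised to have square
`1`. -/
def hyperbolicVol (i : Fin n) : CliffordAlgebra (oddForm n) :=
  ι (oddForm n) (vecE n i) * ι (oddForm n) (vecF n i) -
    ι (oddForm n) (vecF n i) * ι (oddForm n) (vecE n i)

theorem commute_sub_of_anticomm {A : Type*} [Ring A] {a b x : A} (ha : a * x = -(x * a))
    (hb : b * x = -(x * b)) : Commute (a * b - b * a) x := by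
  have h1 : a * b * x = x * (a * b) := by
    rw [mul_assoc, hb, mul_neg, ← mul_assoc, ha, neg_mul, neg_neg, mul_assoc]
  have h2 : b * a * x = x * (b * a) := by
    rw [mul_assoc, ha, mul_neg, ← mul_assoc, hb, neg_mul, neg_neg, mul_assoc]
  rw [Commute, SemiconjBy, sub_mul, h1, h2, mul_sub]

theorem hyperbolicVol_commute_of_polar {i : Fin n} {v : OddSpace n}
    (hE : QuadraticMap.polar (oddForm n) (vecE n i) v = 0)
    (hF : QuadraticMap.polar (oddForm n) (vecF n i) v = 0) :
    Commute (hyperbolicVol i) (ι (oddForm n) v) :=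
  commute_sub_of_anticomm (ι_mul_ι_of_polar_eq_zero hE) (ι_mul_ι_of_polar_eq_zero hF)

theorem hyperbolicVol_mul_vecE (i : Fin n) :
    hyperbolicVol i * ι (oddForm n) (vecE n i) = -(ι (oddForm n) (vecE n i) * hyperbolicVol i) := by
  have h := ι_vecE_sq i
  simp only [hyperbolicVol, sub_mul, mul_sub, mul_assoc, h]
  simp only [← mul_assoc, h]
  simp

theorem hyperbolicVol_mul_vecF (i : Fin n) :
    hyperbolicVol i * ι (oddForm n) (vecF n i) = -(ι (oddForm n) (vecF n i) * hyperbolicVol i) := by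
  have h := ι_vecF_sq i
  simp only [hyperbolicVol, sub_mul, mul_sub, mul_assoc, h]
  simp only [← mul_assoc, h]
  simp

theorem hyperbolicVol_sq (i : Fin n) :
    hyperbolicVol i * hyperbolicVol i = (1 : CliffordAlgebra (oddForm n)) := by
  have h := ι_vecE_mul_ι_vecF i
  have hE := ι_vecE_sq i
  have hF := ι_vecF_sq i
  have hx : ι (oddForm n) (vecF n i) * ι (oddForm n) (vecE n i) *
      (ι (oddForm n) (vecF n i) * ι (oddForm n) (vecE n i)) =
      ι (oddForm n) (vecF n i) * ι (oddForm n) (vecE n i) := by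
    rw [mul_assoc, ← mul_assoc (ι (oddForm n) (vecE n i)), h, sub_mul, one_mul, mul_assoc _ _
      (ι (oddForm n) (vecE n i)), hE, mul_zero, sub_zero]
  rw [hyperbolicVol, h]
  set x := ι (oddForm n) (vecF n i) * ι (oddForm n) (vecE n i)
  have : (1 - x - x) * (1 - x - x) = 1 - 4 * x + 4 * (x * x) := by noncomm_ring
  rw [this, hx]
  noncomm_ring

/-- The product of the `eᵢfᵢ - fᵢeᵢ` over `i ∈ s`, described by its commutation relations: it
anticommutes with the `eᵢ`, `fᵢ` for `i ∈ s` and commutes with the other basis vectors. -/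
theorem exists_partial_vol (s : Finset (Fin n)) :
    ∃ η : CliffordAlgebra (oddForm n), η * η = 1 ∧
      (∀ i ∈ s, η * ι (oddForm n) (vecE n i) = -(ι (oddForm n) (vecE n i) * η) ∧
        η * ι (oddForm n) (vecF n i) = -(ι (oddForm n) (vecF n i) * η)) ∧
      (∀ i ∉ s, Commute η (ι (oddForm n) (vecE n i)) ∧ Commute η (ι (oddForm n) (vecF n i))) ∧
      Commute η (ι (oddForm n) (vecZ n)) ∧
      ∀ b, (∀ v, ι (oddForm n) v * b = -(b * ι (oddForm n) v)) → Commute η b := by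
  classical
  induction s using Finset.induction_on with
  | empty => exact ⟨1, by simp, by simp, by simp, Commute.one_left _, fun _ _ => Commute.one_left _⟩
  | insert j s hj ih =>
    obtain ⟨η, hsq, hs, hns, hz, hb⟩ := ih
    have hηj : Commute η (hyperbolicVol j) :=
      ((hns j hj).1.mul_right (hns j hj).2).sub_right ((hns j hj).2.mul_right (hns j hj).1)
    have hne : ∀ i, i ≠ j → Commute (hyperbolicVol j) (ι (oddForm n) (vecE n i)) ∧
        Commute (hyperbolicVol j) (ι (oddForm n) (vecF n i)) := by
      intro i hij
      constructor <;> refine hyperbolicVol_commute_of_polar ?_ ?_ <;>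
        simp [polar_oddForm, vecE, vecF, Pi.single_apply, hij]
    refine ⟨hyperbolicVol j * η, ?_, fun i hi => ?_, fun i hi => ?_, ?_, fun b hbv => ?_⟩
    · rw [mul_assoc, ← mul_assoc η, hηj.eq, mul_assoc, hsq, mul_one, hyperbolicVol_sq]
    · by_cases hij : i = j
      · subst hij
        have h1 := (hns i hj).1.eq
        have h2 := (hns i hj).2.eq
        constructor
        · rw [mul_assoc, h1, ← mul_assoc, hyperbolicVol_mul_vecE, neg_mul, mul_assoc]
        · rw [mul_assoc, h2, ← mul_assoc, hyperbolicVol_mul_vecF, neg_mul, mul_assoc]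
      · have his := (Finset.mem_insert.1 hi).resolve_left hij
        have h1 := (hne i hij).1.eq
        have h2 := (hne i hij).2.eq
        constructor
        · rw [mul_assoc, (hs i his).1, mul_neg, ← mul_assoc, h1, mul_assoc]
        · rw [mul_assoc, (hs i his).2, mul_neg, ← mul_assoc, h2, mul_assoc]
    · rw [Finset.mem_insert, not_or] at hi
      exact ⟨(hne i hi.1).1.mul_left (hns i hi.2).1, (hne i hi.1).2.mul_left (hns i hi.2).2⟩
    · refine Commute.mul_left (hyperbolicVol_commute_of_polar ?_ ?_) hz <;>
        simp [polar_oddForm, vecE, vecF, vecZ]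
    · exact (commute_sub_of_anticomm (hbv _) (hbv _)).mul_left (hb b hbv)

/-- An element anticommuting with all vectors vanishes: it both commutes and anticommutes with the
invertible volume element, which is central because the dimension is odd. -/
theorem eq_zero_of_anticomm_ι {b : CliffordAlgebra (oddForm n)}
    (hb : ∀ v, ι (oddForm n) v * b = -(b * ι (oddForm n) v)) : b = 0 := by
  obtain ⟨η, hsq, hη, -, hz, hηb⟩ := exists_partial_vol (Finset.univ : Finset (Fin n))
  have hzE : ∀ i, ι (oddForm n) (vecZ n) * ι (oddForm n) (vecE n i) =
      -(ι (oddForm n) (vecE n i) * ι (oddForm n) (vecZ n)) := fun i =>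
    ι_mul_ι_of_polar_eq_zero (by simp [polar_oddForm, vecZ, vecE])
  have hzF : ∀ i, ι (oddForm n) (vecZ n) * ι (oddForm n) (vecF n i) =
      -(ι (oddForm n) (vecF n i) * ι (oddForm n) (vecZ n)) := fun i =>
    ι_mul_ι_of_polar_eq_zero (by simp [polar_oddForm, vecZ, vecF])
  -- `η * z₀` is the volume element
  have hv : ∀ v, Commute (η * ι (oddForm n) (vecZ n)) (ι (oddForm n) v) := by
    refine induction_oddSpace (fun i => ?_) (fun i => ?_) (hz.mul_left (Commute.refl _))
      (fun v w h1 h2 => ?_) fun c v h => ?_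
    · rw [Commute, SemiconjBy, mul_assoc, hzE, mul_neg, ← mul_assoc, (hη i (Finset.mem_univ i)).1]
      simp [mul_assoc]
    · rw [Commute, SemiconjBy, mul_assoc, hzF, mul_neg, ← mul_assoc, (hη i (Finset.mem_univ i)).2]
      simp [mul_assoc]
    · rw [map_add]
      exact h1.add_right h2
    · rw [map_smul]
      exact h.smul_right c
  have hcentral : ∀ x, Commute (η * ι (oddForm n) (vecZ n)) x := by
    intro x
    induction x using CliffordAlgebra.left_induction with
    | algebraMap r => exact (Algebra.commutes r _).symm
    | add x y hx hy => exact hx.add_right hy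
    | ι_mul x m hx => exact (hv m).mul_right hx
  have h1 : η * ι (oddForm n) (vecZ n) * b = -(η * ι (oddForm n) (vecZ n) * b) := by
    conv_rhs => rw [(hcentral b).eq, ← mul_assoc, ← (hηb b hb).eq]
    rw [mul_assoc, hb, mul_neg, mul_assoc]
  have h2 : η * ι (oddForm n) (vecZ n) * b = 0 := by
    have h3 := add_eq_zero_iff_eq_neg.2 h1
    rw [← two_smul ℂ] at h3
    exact (smul_eq_zero.1 h3).resolve_left two_ne_zero
  calc b = (η * η) * (ι (oddForm n) (vecZ n) * ι (oddForm n) (vecZ n)) * b := by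
        rw [hsq, ι_vecZ_sq, one_mul, one_mul]
    _ = η * ι (oddForm n) (vecZ n) * (η * ι (oddForm n) (vecZ n) * b) := by
        have := hz.eq
        simp only [mul_assoc]
        rw [← mul_assoc _ η (_ * b), ← this]
        simp only [mul_assoc]
    _ = 0 := by rw [h2, mul_zero]

/-- An element commuting with products of two unit vectors commutes with all products `v z₀`: each
of `eᵢ`, `fᵢ` is a combination of the unit vectors `eᵢ + fᵢ` and `2eᵢ + fᵢ/2`. -/
theorem commute_ι_mul_ι_vecZ {x : CliffordAlgebra (oddForm n)}
    (hx : ∀ v w, oddForm n v = 1 → oddForm n w = 1 →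
      Commute x (ι (oddForm n) v * ι (oddForm n) w)) (v : OddSpace n) :
    Commute x (ι (oddForm n) v * ι (oddForm n) (vecZ n)) := by
  have hZ : oddForm n (vecZ n) = 1 := by simp [oddForm_apply, vecZ]
  have hadd : ∀ v w, Commute x (ι (oddForm n) v * ι (oddForm n) (vecZ n)) →
      Commute x (ι (oddForm n) w * ι (oddForm n) (vecZ n)) →
      Commute x (ι (oddForm n) (v + w) * ι (oddForm n) (vecZ n)) := fun v w h1 h2 => by
    rw [map_add, add_mul]
    exact h1.add_right h2
  have hsmul : ∀ (c : ℂ) v, Commute x (ι (oddForm n) v * ι (oddForm n) (vecZ n)) →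
      Commute x (ι (oddForm n) (c • v) * ι (oddForm n) (vecZ n)) := fun c v h => by
    rw [map_smul, smul_mul_assoc]
    exact h.smul_right c
  have h1 := fun i => hx _ _ ((oddForm_vec n i 1 1).trans (by norm_num)) hZ
  have h2 := fun i => hx _ _ ((oddForm_vec n i 2 (1 / 2)).trans (by norm_num)) hZ
  refine induction_oddSpace (fun i => ?_) (fun i => ?_) (hx _ _ hZ hZ) hadd hsmul v
  · convert hadd _ _ (hsmul (-1 / 3) _ (h1 i)) (hsmul (2 / 3) _ (h2 i)) using 3
    module
  · convert hadd _ _ (hsmul (4 / 3) _ (h1 i)) (hsmul (-2 / 3) _ (h2 i)) using 3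
    module

/-- An element `x` commuting with the products of two unit vectors commutes with all vectors.
With `x' = z₀xz₀` one finds `xv = vx'` and `x'v = vx`, so that `x - x'` anticommutes with all
vectors and vanishes. -/
theorem commute_ι_of_commute_ι_mul_ι {x : CliffordAlgebra (oddForm n)}
    (hx : ∀ v w, oddForm n v = 1 → oddForm n w = 1 →
      Commute x (ι (oddForm n) v * ι (oddForm n) w)) (v : OddSpace n) :
    Commute x (ι (oddForm n) v) := by
  have hvZ := commute_ι_mul_ι_vecZ hx
  have hZv : ∀ v, Commute x (ι (oddForm n) (vecZ n) * ι (oddForm n) v) := fun v => by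
    rw [← sub_eq_of_eq_add (ι_mul_ι_add_swap (vecZ n) v).symm]
    exact Commute.sub_right (Algebra.commutes _ _).symm (hvZ v)
  have hsq := ι_vecZ_sq (n := n)
  set ζ := ι (oddForm n) (vecZ n)
  have h1 : ∀ v, x * ι (oddForm n) v = ι (oddForm n) v * (ζ * x * ζ) := fun v => by
    calc x * ι (oddForm n) v = x * (ι (oddForm n) v * ζ) * ζ := by
          rw [mul_assoc, mul_assoc (ι _ _), hsq, mul_one]
      _ = _ := by rw [(hvZ v).eq]; simp only [mul_assoc]
  have h2 : ∀ v, ζ * x * ζ * ι (oddForm n) v = ι (oddForm n) v * x := fun v => by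
    rw [mul_assoc (ζ * x), mul_assoc, (hZv v).eq, ← mul_assoc, ← mul_assoc, hsq, one_mul]
  have h3 : x - ζ * x * ζ = 0 := by
    refine eq_zero_of_anticomm_ι fun v => ?_
    rw [mul_sub, sub_mul, h1, h2]
    abel
  rw [Commute, SemiconjBy, h1, ← sub_eq_zero.1 h3]

/-- The centre of `Spin_{2n+1}(ℂ)` is contained in `{1, -1}`. -/
theorem spinGroup_center_eq_one_or_neg_one {g : OddSpin n} (hg : g ∈ Subgroup.center (OddSpin n)) :
    (g : CliffordAlgebra (oddForm n)) = 1 ∨ (g : CliffordAlgebra (oddForm n)) = -1 := by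
  have hcomm : ∀ v, Commute (g : CliffordAlgebra (oddForm n)) (ι (oddForm n) v) :=
    commute_ι_of_commute_ι_mul_ι fun v w hv hw =>
      congrArg Subtype.val ((Subgroup.mem_center_iff.1 hg) ⟨_, mul_mem_spinGroup _ hv hw⟩).symm
  obtain ⟨r, hr⟩ := mem_range_algebraMap_of_contractLeft_eq_zero
      (x := (g : CliffordAlgebra (oddForm n))) fun d => by
    obtain ⟨v, rfl⟩ := exists_polarBilin_oddForm_eq d
    rw [← ι_mul_sub_involute_mul_ι, spinGroup.involute_eq g.2, (hcomm v).eq, sub_self]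
  -- a scalar `r` in the spin group satisfies `r * r = star r * r = 1`
  have h := spinGroup.coe_star_mul_self g
  have hstar : star (algebraMap ℂ (CliffordAlgebra (oddForm n)) r) = algebraMap ℂ _ r :=
    CliffordAlgebra.star_algebraMap r
  rw [hr, hstar, ← map_mul, ← map_one (algebraMap ℂ _)] at h
  have h' := algebraMap_injective_of_invertible_two (oddForm n) h
  rcases mul_self_eq_one_iff.1 h' with rfl | rfl
  · left; rw [hr, map_one]
  · right; rw [hr, map_neg, map_one]

end OddCenter

/-! ### Central characters of irreducible representations -/

section CentralCharacter

variable {G V : Type*} [Group G] [AddCommGroup V] [Module ℂ V] {ρ : Representation ℂ G V}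

/-- Schur's lemma for central elements. -/
theorem exists_scalar_of_mem_center [FiniteDimensional ℂ V] (hρ : ρ.IsIrreducible) {z : G}
    (hz : z ∈ Subgroup.center G) : ∃ c : ℂ, ∀ v, ρ z v = c • v := by
  let T : Representation.IntertwiningMap ρ ρ :=
    { toLinearMap := ρ z
      isIntertwining' := fun g => by
        rw [← Module.End.mul_eq_comp, ← Module.End.mul_eq_comp, ← map_mul, ← map_mul,
          Subgroup.mem_center_iff.1 hz g] }
  obtain ⟨c, hc⟩ :=
    (Representation.IsIrreducible.algebraMap_intertwiningMap_bijective_of_isAlgClosed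
      (ρ := ρ)).2 T
  refine ⟨c, fun v => ?_⟩
  have := congrArg (fun S : Representation.IntertwiningMap ρ ρ => S.toLinearMap v) hc
  exact this.symm

/-- The central character can be read off from any nonzero vector, in particular from a highest
weight vector. -/
theorem IsCentralCharacter.apply_eq {ω : Subgroup.center G →* ℂˣ} (hω : IsCentralCharacter ρ ω)
    {z : Subgroup.center G} {c : ℂ} {v : V} (hv : v ≠ 0) (h : ρ z v = c • v) : (ω z : ℂ) = c :=
  smul_left_injective ℂ hv ((hω z v).symm.trans h)

theorem existsUnique_isCentralCharacter [FiniteDimensional ℂ V] (hρ : ρ.IsIrreducible) :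
    ∃! ω : Subgroup.center G →* ℂˣ, IsCentralCharacter ρ ω := by
  have hV : ∃ v : V, v ≠ 0 := by
    by_contra! h
    refine bot_ne_top (α := Subrepresentation ρ) (SetLike.ext fun v => ?_)
    rw [h v]
    exact ⟨fun _ => Submodule.zero_mem _, fun _ => Submodule.zero_mem _⟩
  obtain ⟨v, hv⟩ := hV
  choose c hc using fun z : Subgroup.center G => exists_scalar_of_mem_center hρ z.2
  let χ : Subgroup.center G →* ℂ :=
    { toFun := c
      map_one' := smul_left_injective ℂ hv <| by
        change c 1 • v = (1 : ℂ) • v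
        rw [← hc]; simp
      map_mul' := fun x y => smul_left_injective ℂ hv <| by
        change c (x * y) • v = (c x * c y) • v
        rw [← hc, mul_smul, ← hc y, ← hc x]; simp }
  refine ⟨χ.toHomUnits, fun z w => hc z w, fun ω hω => ?_⟩
  ext z
  exact hω.apply_eq hv (hc z v)

end CentralCharacter

/-! ### The representations of `SL_{2n}(ℂ)` -/

section SpecialLinear

open Matrix

theorem slWeight_of_eq_scalar {N : ℕ} (a : Fin (N - 1) → ℕ) {g : SLTorus N} {r : ℂ}
    (hg : scalar (Fin N) r = (g.1 : Matrix (Fin N) (Fin N) ℂ)) :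
    slWeight N a g = ∏ i : Fin (N - 1), r ^ (((i : ℕ) + 1) * a i) := by
  refine Finset.prod_congr rfl fun i _ => ?_
  have hcard : (Finset.univ.filter fun j : Fin N => (j : ℕ) ≤ (i : ℕ)).card = (i : ℕ) + 1 := by
    rw [show (Finset.univ.filter fun j : Fin N => (j : ℕ) ≤ (i : ℕ)) =
      Finset.Iic (⟨i, by omega⟩ : Fin N) by ext j; simp [Fin.le_def], Fin.card_Iic]
  rw [← hg, pow_mul]
  simp [hcard]

/-- If `a` is symmetric and `r ^ (2n) = 1`, the factors with (unshifted) indices `i` and `2n - i`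
cancel, so that only the middle one remains. -/
theorem prod_pow_of_selfdual {n : ℕ} {k : Fin (2 * n - 1)} (hk : (k : ℕ) + 1 = n)
    {a : Fin (2 * n - 1) → ℕ} (ha : ∀ i, a (Fin.rev i) = a i) {r : ℂ} (hr : r ^ (2 * n) = 1) :
    ∏ i : Fin (2 * n - 1), r ^ (((i : ℕ) + 1) * a i) = (r ^ n) ^ a k := by
  rw [← Finset.mul_prod_erase _ _ (Finset.mem_univ k),
    Finset.prod_involution fun i _ => Fin.rev i, mul_one, ← pow_mul]
  · rw [hk]
  · intro i _
    rw [ha, ← pow_add, ← add_mul, Fin.val_rev,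
      show (i : ℕ) + 1 + (2 * n - 1 - (i + 1) + 1) = 2 * n by omega, pow_mul, hr, one_pow]
  · intro i hi _ h
    refine Finset.ne_of_mem_erase hi (Fin.ext ?_)
    have := congrArg Fin.val h
    rw [Fin.val_rev] at this
    omega
  · intro i hi
    refine Finset.mem_erase.2 ⟨fun h => Finset.ne_of_mem_erase hi (Fin.ext ?_), Finset.mem_univ _⟩
    have := congrArg Fin.val h
    rw [Fin.val_rev] at this
    omega
  · exact fun i _ => Fin.rev_rev i

theorem IsSLRep.centralCharacter_apply {n : ℕ} {k : Fin (2 * n - 1)} (hk : (k : ℕ) + 1 = n)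
    {a : Fin (2 * n - 1) → ℕ} (ha : ∀ i, a (Fin.rev i) = a i)
    {V : Type*} [AddCommGroup V] [Module ℂ V]
    {ρ : Representation ℂ (SpecialLinearGroup (Fin (2 * n)) ℂ) V} (hρ : IsSLRep (2 * n) a ρ)
    {ω : Subgroup.center (SpecialLinearGroup (Fin (2 * n)) ℂ) →* ℂˣ}
    (hω : IsCentralCharacter ρ ω) {z : Subgroup.center (SpecialLinearGroup (Fin (2 * n)) ℂ)}
    {r : ℂ} (hr : r ^ (2 * n) = 1)
    (hz : scalar (Fin (2 * n)) r = (z.1 : Matrix (Fin (2 * n)) (Fin (2 * n)) ℂ)) :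
    (ω z : ℂ) = (r ^ n) ^ a k := by
  obtain ⟨v, hv, -, ht⟩ := hρ.highestWeight
  have hdiag : (z.1 : Matrix (Fin (2 * n)) (Fin (2 * n)) ℂ).IsDiag := by
    rw [← hz, scalar_apply]
    exact isDiag_diagonal _
  rw [hω.apply_eq hv (ht ⟨z.1, hdiag⟩), slWeight_of_eq_scalar a hz, prod_pow_of_selfdual hk ha hr]

theorem IsSLRep.centralCharacter {n : ℕ} {k : Fin (2 * n - 1)} (hk : (k : ℕ) + 1 = n)
    {a : Fin (2 * n - 1) → ℕ} (ha : ∀ i, a (Fin.rev i) = a i)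
    {V : Type*} [AddCommGroup V] [Module ℂ V]
    {ρ : Representation ℂ (SpecialLinearGroup (Fin (2 * n)) ℂ) V} (hρ : IsSLRep (2 * n) a ρ)
    {ω : Subgroup.center (SpecialLinearGroup (Fin (2 * n)) ℂ) →* ℂˣ}
    (hω : IsCentralCharacter ρ ω) :
    ω ^ 2 = 1 ∧ (ω = 1 ↔ Even (a k)) := by
  have key : ∀ z, ∃ ε : ℂ, ε ^ 2 = 1 ∧ (ω z : ℂ) = ε ^ a k := by
    intro z
    obtain ⟨r, hr, hz⟩ := Matrix.SpecialLinearGroup.mem_center_iff.1 z.2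
    rw [Fintype.card_fin] at hr
    exact ⟨r ^ n, by rw [← pow_mul, mul_comm, hr], hρ.centralCharacter_apply hk ha hω hr hz⟩
  refine ⟨?_, fun h => ?_, fun h => ?_⟩
  · ext z
    obtain ⟨ε, hε, hz⟩ := key z
    simp [hz, ← pow_mul, mul_comm _ 2, pow_mul ε 2, hε]
  · -- a primitive `2n`-th root of unity `ζ` satisfies `ζ ^ n = -1`
    have hprim := Complex.isPrimitiveRoot_exp (2 * n) (by omega)
    set ζ := Complex.exp (2 * Real.pi * Complex.I / (2 * n : ℕ))
    have hn1 : ζ ^ n = -1 := by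
      have h1 : ζ ^ n ≠ 1 := hprim.pow_ne_one_of_pos_of_lt (by omega) (by omega)
      refine (mul_self_eq_one_iff.1 ?_).resolve_left h1
      rw [← pow_add, ← two_mul, hprim.pow_eq_one]
    let g : SpecialLinearGroup (Fin (2 * n)) ℂ :=
      ⟨scalar (Fin (2 * n)) ζ, by simp [hprim.pow_eq_one]⟩
    have hg : g ∈ Subgroup.center (SpecialLinearGroup (Fin (2 * n)) ℂ) :=
      Matrix.SpecialLinearGroup.mem_center_iff.2 ⟨ζ, by rw [Fintype.card_fin, hprim.pow_eq_one], rfl⟩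
    have := hρ.centralCharacter_apply hk ha hω (z := ⟨g, hg⟩) hprim.pow_eq_one rfl
    rw [h, hn1] at this
    exact neg_one_pow_eq_one_iff_even (by norm_num) |>.1 this.symm
  · obtain ⟨l, hl⟩ := h
    ext z
    obtain ⟨ε, hε, hz⟩ := key z
    rw [hz, hl, ← two_mul, pow_mul, hε, one_pow]
    rfl

end SpecialLinear

/-! ### The representations of `Spin_{2n+1}(ℂ)` -/

section Spin

open CliffordAlgebra

theorem spinCochar_one (n : ℕ) (i : Fin n) : spinCochar n i 1 = 1 := by
  refine Subtype.ext ?_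
  change ι _ _ * ι _ _ = 1
  rw [inv_one, Units.val_one, ι_sq_scalar, oddForm_vec, one_mul, map_one]

theorem coe_spinCochar_neg_one (n : ℕ) (i : Fin n) :
    (spinCochar n i (-1) : CliffordAlgebra (oddForm n)) = -1 := by
  change ι _ _ * ι _ _ = -1
  rw [show (((-1 : ℂˣ)⁻¹ : ℂˣ) : ℂ) • vecE n i + ((-1 : ℂˣ) : ℂ) • vecF n i =
    -((1 : ℂ) • vecE n i + (1 : ℂ) • vecF n i) by simp [add_comm], map_neg, mul_neg, ι_sq_scalar,
    oddForm_vec, one_mul, map_one]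

/-- The central element `-1` is the torus element with parameters `(-1, 1, …, 1)`. -/
theorem coe_spinTorus_mulSingle_zero (m : ℕ) :
    (spinTorus (m + 1) (Pi.mulSingle 0 (-1)) : CliffordAlgebra (oddForm (m + 1))) = -1 := by
  rw [spinTorus, List.ofFn_succ, List.prod_cons, List.prod_eq_one, mul_one, Pi.mulSingle_eq_same,
    coe_spinCochar_neg_one]
  intro x hx
  obtain ⟨i, rfl⟩ := (List.mem_ofFn' _ _).1 hx
  simp [spinCochar_one]

/-- At parameters `±1`, exactly one of them `-1`, the fundamental weights `ϖᵢ`, `i < n`, take the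
value `1`, being products of squares, whereas `ϖₙ` takes the value `-1`. -/
theorem spinWeight_mulSingle_neg_one {n : ℕ} (a : Fin n → ℕ) {k : Fin n} (hk : (k : ℕ) + 1 = n)
    (i₀ : Fin n) :
    spinWeight n a (Pi.mulSingle i₀ (-1)) = (-1) ^ a k := by
  have hsq : ∀ j, ((Pi.mulSingle i₀ (-1) : Fin n → ℂˣ) j : ℂ) ^ 2 = 1 := by
    intro j
    rcases eq_or_ne j i₀ with rfl | h
    · simp
    · simp [Pi.mulSingle_eq_of_ne h]
  rw [spinWeight, Finset.prod_eq_single k]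
  · rw [spinFundWeight, if_neg (by omega), ← Units.coe_prod, Finset.prod_pi_mulSingle']
    simp
  · intro i _ hi
    have h1 : (i : ℕ) + 1 < n := by
      have := i.2
      have : (i : ℕ) ≠ k := fun h => hi (Fin.ext h)
      omega
    rw [spinFundWeight, if_pos h1, Finset.prod_eq_one fun j _ => hsq j, one_pow]
  · simp

theorem IsSpinRep.centralCharacter {n : ℕ} {k : Fin n} (hk : (k : ℕ) + 1 = n) {a : Fin n → ℕ}
    {V : Type*} [AddCommGroup V] [Module ℂ V] {ρ : Representation ℂ (OddSpin n) V}
    (hρ : IsSpinRep n a ρ) {ω : Subgroup.center (OddSpin n) →* ℂˣ}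
    (hω : IsCentralCharacter ρ ω) :
    ω ^ 2 = 1 ∧ (ω = 1 ↔ Even (a k)) := by
  obtain ⟨m, rfl⟩ := Nat.exists_eq_succ_of_ne_zero (n := n) (by omega)
  obtain ⟨v, hv, -, ht⟩ := hρ.highestWeight
  set t := spinTorus (m + 1) (Pi.mulSingle 0 (-1))
  have htc : (t : CliffordAlgebra (oddForm (m + 1))) = -1 := coe_spinTorus_mulSingle_zero m
  have htmem : t ∈ Subgroup.center (OddSpin (m + 1)) := by
    refine Subgroup.mem_center_iff.2 fun g => Subtype.ext ?_
    change (g : CliffordAlgebra (oddForm (m + 1))) * t = t * g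
    rw [htc]
    simp
  have hωt : (ω ⟨t, htmem⟩ : ℂ) = (-1) ^ a k := by
    rw [hω.apply_eq hv (ht _), spinWeight_mulSingle_neg_one a hk]
  have key : ∀ z : Subgroup.center (OddSpin (m + 1)), z = 1 ∨ z = ⟨t, htmem⟩ := by
    intro z
    refine (spinGroup_center_eq_one_or_neg_one z.2).imp (fun h => ?_) fun h => ?_
    · exact Subtype.ext (Subtype.ext h)
    · exact Subtype.ext (Subtype.ext (h.trans htc.symm))
  refine ⟨?_, fun h => ?_, fun h => ?_⟩
  · ext z
    rcases key z with rfl | rfl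
    · simp
    · simp [hωt, ← pow_mul, mul_comm _ 2, pow_mul _ 2]
  · rw [h] at hωt
    exact neg_one_pow_eq_one_iff_even (by norm_num) |>.1 hωt.symm
  · ext z
    rcases key z with rfl | rfl
    · simp
    · rw [hωt, h.neg_one_pow]
      rfl

end Spin

theorem lemma1 (n : ℕ) (hn : 1 ≤ n) :
    (∀ (a : Fin (2 * n - 1) → ℕ), (∀ i, a (Fin.rev i) = a i) →
      ∀ (V : Type*) [AddCommGroup V] [Module ℂ V]
        (ρ : Representation ℂ (Matrix.SpecialLinearGroup (Fin (2 * n)) ℂ) V),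
        IsSLRep (2 * n) a ρ →
        (∃! ω : Subgroup.center (Matrix.SpecialLinearGroup (Fin (2 * n)) ℂ) →* ℂˣ,
          IsCentralCharacter ρ ω) ∧
        ∀ ω : Subgroup.center (Matrix.SpecialLinearGroup (Fin (2 * n)) ℂ) →* ℂˣ,
          IsCentralCharacter ρ ω → ω ^ 2 = 1 ∧ (ω = 1 ↔ Even (a ⟨n - 1, by omega⟩))) ∧
    (∀ (a : Fin n → ℕ) (V : Type*) [AddCommGroup V] [Module ℂ V]
        (ρ : Representation ℂ (OddSpin n) V),
        IsSpinRep n a ρ →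
        (∃! ω : Subgroup.center (OddSpin n) →* ℂˣ, IsCentralCharacter ρ ω) ∧
        ∀ ω : Subgroup.center (OddSpin n) →* ℂˣ,
          IsCentralCharacter ρ ω → ω ^ 2 = 1 ∧ (ω = 1 ↔ Even (a ⟨n - 1, by omega⟩))) := by
  refine ⟨fun a ha V _ _ ρ hρ => ?_, fun a V _ _ ρ hρ => ?_⟩
  · have := hρ.finiteDimensional
    refine ⟨existsUnique_isCentralCharacter hρ.irreducible, fun ω hω => ?_⟩
    exact hρ.centralCharacter (Nat.sub_add_cancel hn) ha hω
  · have := hρ.finiteDimensional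
    refine ⟨existsUnique_isCentralCharacter hρ.irreducible, fun ω hω => ?_⟩
    exact hρ.centralCharacter (Nat.sub_add_cancel hn) hω
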